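/- **Rudimentary functions** (from tuples of sets to sets) are generated as follows: the functions $F(x_1,\dots,x_n)=x_i$, $F(x_1,\dots,x_n)=\{x_i,x_j\}$ and $F(x_1,\dots,x_n)=x_i\setminus x_j$ are rudimentary, and if $G,H,H_1,\dots,H_k$ are rudimentary then so are $F(x_1,\dots,x_n)=G(H_1(x_1,\dots,x_n),\dots,H_k(x_1,\dots,x_n))$ and $F(x_1,\dots,x_n)=\bigcup_{y\in x_1}H(y,x_2,\dots,x_n)$. The **rudimentary closure** of a set $x$ is the smallest set $y$ such that $x\subseteq y$, $x\in y$, and $y$ is closed under all rudimentary functions. Let $J_1$ be the rudimentary closure of $J_0=\emptyset$, and $J_2$ the rudimentary closure of $J_1$. An **$\iota$-set** is an element of $J_2$. An **$\iota$-class** is a subset $X$ of $J_2$ that is definable over $J_2$ by a first-order formula in the symbols $\in,\subseteq,=$ with quantifiers ranging over $J_2$ and parameters from $J_2$, and such that $X\cap x$ is an $\iota$-set for every $\iota$-set $x$. An **$\iota$-function** from an $\iota$-class $X$ to an $\iota$-class $Y$ is a function $F:X\to Y$ whose graph $\{\langle a,F(a)\rangle : a\in X\}$ (with $\langle a,b\rangle=\{\{a\},\{a,b\}\}$)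 is an $\iota$-class and such that for every $\iota$-set $x\subseteq X$ the image $F[x]$ is contained in an $\iota$-set. An **$\iota$-bijection** from $X$ to $Y$ is a bijection $F:X\to Y$ such that both $F$ and $F^{-1}$ are $\iota$-functions. Natural numbers are the von Neumann ones, $0=\emptyset$, $n+1=\{0,\dots,n\}$, and $\mathbf N=\{0,1,2,\dots\}$. **Theorem 2.10.** Let $x$ be an $\iota$-set. If $x$ is infinite, then there is an $\iota$-bijection from $\mathbf N$ onto $x$. If $x$ is finite, then there is an $\iota$-bijection from some natural number $n\in\mathbf N$ onto $x$. (So $J_2$ internally sees every set as countable.) -/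

import Mathlib

universe u

/-- Rudimentary functions of `n` variables, from tuples of sets to sets. -/
inductive IsRudimentary : (n : ℕ) → ((Fin n → ZFSet.{u}) → ZFSet.{u}) → Prop
  | proj {n : ℕ} (i : Fin n) : IsRudimentary n (fun v => v i)
  | pair {n : ℕ} (i j : Fin n) : IsRudimentary n (fun v => {v i, v j})
  | diff {n : ℕ} (i j : Fin n) : IsRudimentary n (fun v => v i \ v j)
  | comp {n k : ℕ} {G : (Fin k → ZFSet.{u}) → ZFSet.{u}}
      {H : Fin k → (Fin n → ZFSet.{u}) → ZFSet.{u}} :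
      IsRudimentary k G → (∀ i, IsRudimentary n (H i)) →
      IsRudimentary n (fun v => G (fun i => H i v))
  | union {n : ℕ} {H : (Fin (n + 1) → ZFSet.{u}) → ZFSet.{u}} :
      IsRudimentary (n + 1) H →
      IsRudimentary (n + 1)
        (fun v => ZFSet.iUnion (fun y : v 0 => H (Fin.cons y.1 (Fin.tail v))))

/-- `y` is closed under application of all rudimentary functions. -/
def RudClosed (y : ZFSet.{u}) : Prop :=
  ∀ (n : ℕ) (F : (Fin n → ZFSet.{u}) → ZFSet.{u}), IsRudimentary n F →
    ∀ v : Fin n → ZFSet.{u}, (∀ i, v i ∈ y) → F v ∈ y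

/-- `y` is the smallest set that includes `x`, has `x` as an element, and is closed under
application of all rudimentary functions. -/
def IsRudClosure (x y : ZFSet.{u}) : Prop :=
  (x ⊆ y ∧ x ∈ y ∧ RudClosed y) ∧ ∀ z : ZFSet.{u}, x ⊆ z → x ∈ z → RudClosed z → y ⊆ z

/-- A rudimentary function raises rank by at most a fixed finite amount. -/
theorem IsRudimentary.rank_le {n : ℕ} {F : (Fin n → ZFSet.{u}) → ZFSet.{u}}
    (hF : IsRudimentary n F) :
    ∃ k : ℕ, ∀ (a : Ordinal.{u}) (v : Fin n → ZFSet.{u}),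
      (∀ i, (v i).rank ≤ a) → (F v).rank ≤ a + k := by
  induction hF with
  | proj i => exact ⟨0, fun a v hv => by simpa using hv i⟩
  | pair i j =>
    refine ⟨1, fun a v hv => ?_⟩
    rw [ZFSet.rank_pair]
    have := hv i
    have := hv j
    simp [*]
  | diff i j =>
    refine ⟨0, fun a v hv => ?_⟩
    have : v i \ v j ⊆ v i := fun z hz => (ZFSet.mem_sdiff.1 hz).1
    simpa using (ZFSet.rank_mono this).trans (hv i)
  | comp hG hH ihG ihH =>
    obtain ⟨k, hk⟩ := ihG
    choose m hm using ihH
    refine ⟨Finset.univ.sup m + k, fun a v hv => ?_⟩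
    rw [Nat.cast_add, ← add_assoc]
    refine hk _ _ fun i => (hm i a v hv).trans ?_
    gcongr
    exact Finset.le_sup (Finset.mem_univ i)
  | union hH ih =>
    obtain ⟨k, hk⟩ := ih
    refine ⟨k, fun a v hv => ?_⟩
    rw [ZFSet.rank_le_iff]
    intro z hz
    obtain ⟨y, hy⟩ := ZFSet.mem_iUnion.1 hz
    refine (ZFSet.rank_lt_of_mem hy).trans_le (hk a _ fun i => ?_)
    refine Fin.cases ?_ (fun j => ?_) i
    · exact (ZFSet.rank_lt_of_mem y.2).le.trans (hv 0)
    · exact hv j.succ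

theorem exists_rudClosure (x : ZFSet.{u}) : ∃ y, IsRudClosure x y := by
  let V : ZFSet.{u} := ZFSet.vonNeumann (x.rank + Ordinal.omega0)
  have hxV : x.rank < x.rank + Ordinal.omega0 := by
    simp
  have hVx : x ⊆ V := fun z hz =>
    ZFSet.mem_vonNeumann.2 ((ZFSet.rank_lt_of_mem hz).trans hxV)
  have hxm : x ∈ V := ZFSet.mem_vonNeumann.2 hxV
  have hV : RudClosed V := by
    intro n F hF v hv
    obtain ⟨k, hk⟩ := hF.rank_le
    have h1 : ∀ i, ∃ m : ℕ, (v i).rank ≤ x.rank + m := by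
      intro i
      have h := ZFSet.mem_vonNeumann.1 (hv i)
      rw [Ordinal.lt_add_iff (by simp)] at h
      obtain ⟨d, hd, h⟩ := h
      obtain ⟨m, rfl⟩ := Ordinal.lt_omega0.1 hd
      exact ⟨m, h⟩
    choose m hm using h1
    refine ZFSet.mem_vonNeumann.2
      ((hk (x.rank + (Finset.univ.sup m : ℕ)) v fun i => (hm i).trans ?_).trans_lt ?_)
    · gcongr
      exact Finset.le_sup (Finset.mem_univ i)
    · rw [add_assoc, ← Nat.cast_add]
      gcongr
      exact Ordinal.natCast_lt_omega0 _
  refine ⟨V.sep (fun t => ∀ z : ZFSet.{u}, x ⊆ z → x ∈ z → RudClosed z → t ∈ z),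
    ⟨fun t ht => ?_, ?_, ?_⟩, ?_⟩
  · exact ZFSet.mem_sep.2 ⟨hVx ht, fun z hz _ _ => hz ht⟩
  · exact ZFSet.mem_sep.2 ⟨hxm, fun z _ hz _ => hz⟩
  · intro n F hF v hv
    refine ZFSet.mem_sep.2 ⟨hV n F hF v fun i => (ZFSet.mem_sep.1 (hv i)).1, ?_⟩
    intro z h1 h2 h3
    exact h3 n F hF v fun i => (ZFSet.mem_sep.1 (hv i)).2 z h1 h2 h3
  · intro z h1 h2 h3 t ht
    exact (ZFSet.mem_sep.1 ht).2 z h1 h2 h3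

/-- The rudimentary closure of a set. -/
noncomputable def rudClosure (x : ZFSet.{u}) : ZFSet.{u} :=
  Classical.choose (exists_rudClosure x)

theorem rudClosure_spec (x : ZFSet.{u}) : IsRudClosure x (rudClosure x) :=
  Classical.choose_spec (exists_rudClosure x)

/-- `J₁`, the rudimentary closure of `J₀ = ∅`. -/
noncomputable def J1 : ZFSet.{u} := rudClosure ∅

/-- `J₂`, the rudimentary closure of `J₁`. -/
noncomputable def J2 : ZFSet.{u} := rudClosure J1

/-- The two relation symbols of the language of set theory, for `∈` and `⊆`
(equality is a logical symbol). -/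
inductive SetLangRel : ℕ → Type
  | mem : SetLangRel 2
  | sub : SetLangRel 2

/-- The first-order language of set theory. -/
def setLang : FirstOrder.Language.{0, 0} := ⟨fun _ => Empty, SetLangRel⟩

/-- A set `x` as a universe of discourse: variables range over the elements of `x`, and `∈`, `⊆`
have their true meaning. -/
instance setStructure (x : ZFSet.{u}) : setLang.Structure x where
  funMap := fun f _ => Empty.elim f
  RelMap := fun r => match r with
    | SetLangRel.mem => fun v => (v 0).1 ∈ (v 1).1
    | SetLangRel.sub => fun v => (v 0).1 ⊆ (v 1).1

/-- `y` is a definable subset of `x`: it is cut out from `x` by a formula of the language of set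
theory relativized to `x`, with parameters from `x`. -/
def IsDefinableSubset (y x : ZFSet.{u}) : Prop :=
  y ⊆ x ∧ (Set.univ : Set x).Definable₁ setLang {a : x | a.1 ∈ y}

/-- An `ι`-set is an element of `J₂`. -/
def IsIotaSet (x : ZFSet.{u}) : Prop := x ∈ J2

/-- An `ι`-class is a definable subset of `J₂` whose intersection with every `ι`-set is an
`ι`-set. (Every subset of the set `J₂` is a set, so classes are represented as sets.) -/
def IsIotaClass (X : ZFSet.{u}) : Prop :=
  IsDefinableSubset X J2 ∧ ∀ x : ZFSet.{u}, IsIotaSet x → IsIotaSet (X ∩ x)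

/-- The graph of a function, as a set of Kuratowski pairs. -/
def funGraph {X Y : ZFSet.{u}} (F : X → Y) : ZFSet.{u} :=
  (X.prod Y).sep (fun p => ∃ a : X, p = ZFSet.pair a.1 (F a).1)

/-- `ι`-functions between `ι`-classes. -/
def IsIotaFun {X Y : ZFSet.{u}} (F : X → Y) : Prop :=
  IsIotaClass X ∧ IsIotaClass Y ∧ IsIotaClass (funGraph F) ∧
    ∀ x : ZFSet.{u}, IsIotaSet x → x ⊆ X →
      ∃ y : ZFSet.{u}, IsIotaSet y ∧ ∀ a : X, a.1 ∈ x → (F a).1 ∈ y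

/-- An `ι`-bijection is a bijection which is an `ι`-function in both directions. -/
def IsIotaBijection {X Y : ZFSet.{u}} (F : X ≃ Y) : Prop :=
  IsIotaFun (F : X → Y) ∧ IsIotaFun (F.symm : Y → X)

/-!
Every element of `J2` is covered by the values, at parameters from `J1`, of a single rudimentary
function of `J1` and the parameter: this is proved for a transitive "layer" around the element, and
rudimentary functions lead from layers to layers. The set `J1` consists of the hereditarily finite
sets, and Ackermann's coding of these by natural numbers orders it; the ordering is recognised by
its finite attempts, which are elements of `J1`. Taking the parameters that are least for their
values gives a bijection from some `A ⊆ J1` onto the given set. If `A` is infinite, it is numbered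
by counting predecessors, and the count is recognised by finite injections in `J1`. All quantifiers
involved range over sets in `J2`, so that the rudimentary separation available in `J2` produces
these bijections as elements of `J2`.
-/

open ZFSet

/-! ### Rudimentary functions and relations -/

/-- A relation is rudimentary if it is the non-vacuity of a rudimentary function. -/
def IsRudimentaryRel (n : ℕ) (P : (Fin n → ZFSet.{u}) → Prop) : Prop :=
  ∃ F : (Fin n → ZFSet.{u}) → ZFSet.{u}, IsRudimentary n F ∧ ∀ v, P v ↔ (F v).Nonempty

namespace IsRudimentary

variable {n : ℕ} {f g : (Fin n → ZFSet.{u}) → ZFSet.{u}}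

theorem congr (hf : IsRudimentary n f) (h : ∀ v, f v = g v) : IsRudimentary n g := by
  rwa [← funext h]

theorem comp₂ {F : (Fin 2 → ZFSet.{u}) → ZFSet.{u}} (hF : IsRudimentary 2 F)
    (hf : IsRudimentary n f) (hg : IsRudimentary n g) :
    IsRudimentary n (fun v => F ![f v, g v]) :=
  (hF.comp (H := ![f, g]) (by simp [Fin.forall_fin_succ, hf, hg])).congr fun v =>
    congrArg F (by ext i : 1; fin_cases i <;> rfl)

theorem unorderedPair (hf : IsRudimentary n f) (hg : IsRudimentary n g) :
    IsRudimentary n (fun v => {f v, g v}) :=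
  (pair 0 1).comp₂ hf hg

theorem sdiff (hf : IsRudimentary n f) (hg : IsRudimentary n g) :
    IsRudimentary n (fun v => f v \ g v) :=
  (diff 0 1).comp₂ hf hg

theorem singleton (hf : IsRudimentary n f) : IsRudimentary n (fun v => {f v}) :=
  (hf.unorderedPair hf).congr fun v => by simp

theorem weaken (hf : IsRudimentary n f) : IsRudimentary (n + 1) (fun w => f (Fin.tail w)) :=
  hf.comp (H := fun i w => w i.succ) fun i => proj i.succ

theorem iUnion {H : ZFSet.{u} → (Fin n → ZFSet.{u}) → ZFSet.{u}} (hf : IsRudimentary n f)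
    (hH : IsRudimentary (n + 1) (fun w => H (w 0) (Fin.tail w))) :
    IsRudimentary n (fun v => ZFSet.iUnion fun y : f v => H y v) :=
  (union hH).comp (H := Fin.cons f fun i v => v i) (Fin.cases hf proj)

theorem sUnion (hf : IsRudimentary n f) : IsRudimentary n (fun v => ⋃₀ f v) :=
  (hf.iUnion (H := fun y _ => y) (proj 0)).congr fun v => by ext; simp

theorem union' (hf : IsRudimentary n f) (hg : IsRudimentary n g) :
    IsRudimentary n (fun v => f v ∪ g v) :=
  (hf.unorderedPair hg).sUnion

theorem insert (hf : IsRudimentary n f) (hg : IsRudimentary n g) :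
    IsRudimentary n (fun v => insert (f v) (g v)) :=
  (hf.singleton.union' hg).congr fun v => by ext; simp

theorem inter (hf : IsRudimentary n f) (hg : IsRudimentary n g) :
    IsRudimentary n (fun v => f v ∩ g v) :=
  (hf.sdiff (hf.sdiff hg)).congr fun v => by ext; simp +contextual

theorem kpair (hf : IsRudimentary n f) (hg : IsRudimentary n g) :
    IsRudimentary n (fun v => ZFSet.pair (f v) (g v)) :=
  hf.singleton.unorderedPair (hf.unorderedPair hg)

theorem sep {P : ZFSet.{u} → (Fin n → ZFSet.{u}) → Prop} (hf : IsRudimentary n f)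
    (hP : IsRudimentaryRel (n + 1) (fun w => P (w 0) (Fin.tail w))) :
    IsRudimentary n (fun v => (f v).sep fun z => P z v) := by
  obtain ⟨F, hF, h⟩ := hP
  have hcons : IsRudimentary (n + 1) (fun w => F (Fin.cons (w 0) (Fin.tail w))) := by simpa using hF
  have hguarded : IsRudimentary (n + 1)
      (fun w => ZFSet.iUnion fun _ : F (Fin.cons (w 0) (Fin.tail w)) => {w 0}) :=
    hcons.iUnion (H := fun _ w => {w 0}) (singleton (proj 1))
  refine (hf.iUnion (H := fun y v => ZFSet.iUnion fun _ : F (Fin.cons y v) => {y})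
    hguarded).congr fun v => ?_
  ext z
  have hz : P z v ↔ ∃ x, x ∈ F (Fin.cons z v) := h (Fin.cons z v)
  simp only [mem_iUnion, mem_singleton, mem_sep, hz, Subtype.exists]
  grind

theorem prod (hf : IsRudimentary n f) (hg : IsRudimentary n g) :
    IsRudimentary n (fun v => (f v).prod (g v)) := by
  refine (hf.iUnion
    (H := fun a v => ZFSet.iUnion fun b : g v => {ZFSet.pair a b})
    (hg.weaken.iUnion (H := fun b w => {ZFSet.pair (w 0) b})
      (singleton (kpair (proj 1) (proj 0))))).congr fun v => ?_
  ext z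
  simp

end IsRudimentary

namespace IsRudimentaryRel

variable {n : ℕ} {P Q : (Fin n → ZFSet.{u}) → Prop} {f g : (Fin n → ZFSet.{u}) → ZFSet.{u}}

theorem congr (hP : IsRudimentaryRel n P) (h : ∀ v, P v ↔ Q v) : IsRudimentaryRel n Q := by
  rwa [← funext fun v => propext (h v)]

theorem comp {k : ℕ} {P : (Fin k → ZFSet.{u}) → Prop}
    {H : Fin k → (Fin n → ZFSet.{u}) → ZFSet.{u}} (hP : IsRudimentaryRel k P)
    (hH : ∀ i, IsRudimentary n (H i)) : IsRudimentaryRel n (fun v => P fun i => H i v) := by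
  obtain ⟨F, hF, h⟩ := hP
  exact ⟨_, hF.comp hH, fun v => h _⟩

theorem mem (hf : IsRudimentary n f) (hg : IsRudimentary n g) :
    IsRudimentaryRel n (fun v => f v ∈ g v) :=
  ⟨_, hf.singleton.inter hg, fun v => by simp [ZFSet.nonempty_def]⟩

theorem eq (hf : IsRudimentary n f) (hg : IsRudimentary n g) :
    IsRudimentaryRel n (fun v => f v = g v) :=
  (mem hf hg.singleton).congr fun v => by simp

theorem not (hP : IsRudimentaryRel n P) : IsRudimentaryRel n (fun v => ¬ P v) := by
  obtain ⟨F, hF, h⟩ := hP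
  refine ⟨_, hF.singleton.sdiff (hF.iUnion (H := fun _ v => {F v}) hF.singleton.weaken),
    fun v => ?_⟩
  simp [h, ZFSet.nonempty_def]

theorem and (hP : IsRudimentaryRel n P) (hQ : IsRudimentaryRel n Q) :
    IsRudimentaryRel n (fun v => P v ∧ Q v) := by
  obtain ⟨F, hF, hPF⟩ := hP
  obtain ⟨G, hG, hQG⟩ := hQ
  refine ⟨_, hF.iUnion (H := fun _ v => G v) hG.weaken, fun v => ?_⟩
  simp [hPF, hQG, ZFSet.nonempty_def]

theorem imp (hP : IsRudimentaryRel n P) (hQ : IsRudimentaryRel n Q) :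
    IsRudimentaryRel n (fun v => P v → Q v) :=
  (hP.and hQ.not).not.congr fun v => by tauto

theorem iff (hP : IsRudimentaryRel n P) (hQ : IsRudimentaryRel n Q) :
    IsRudimentaryRel n (fun v => (P v ↔ Q v)) :=
  ((hP.imp hQ).and (hQ.imp hP)).congr fun v => by tauto

theorem exists_mem {P : ZFSet.{u} → (Fin n → ZFSet.{u}) → Prop} (hf : IsRudimentary n f)
    (hP : IsRudimentaryRel (n + 1) (fun w => P (w 0) (Fin.tail w))) :
    IsRudimentaryRel n (fun v => ∃ z ∈ f v, P z v) :=
  ⟨_, hf.sep hP, fun v => by simp [ZFSet.nonempty_def]⟩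

theorem forall_mem {P : ZFSet.{u} → (Fin n → ZFSet.{u}) → Prop} (hf : IsRudimentary n f)
    (hP : IsRudimentaryRel (n + 1) (fun w => P (w 0) (Fin.tail w))) :
    IsRudimentaryRel n (fun v => ∀ z ∈ f v, P z v) :=
  (exists_mem (P := fun z v => ¬ P z v) hf hP.not).not.congr fun v => by simp

theorem isTransitive (hf : IsRudimentary n f) :
    IsRudimentaryRel n (fun v => (f v).IsTransitive) := by
  have h : IsRudimentaryRel n (fun v => ∀ y ∈ f v, ∀ z ∈ y, z ∈ f v) :=
    forall_mem (P := fun y v => ∀ z ∈ y, z ∈ f v) hf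
      (forall_mem (P := fun z w => z ∈ f (Fin.tail w)) (.proj 0) (mem (.proj 0) hf.weaken.weaken))
  exact h

end IsRudimentaryRel

/-- The first component of a Kuratowski pair. -/
noncomputable def kpairFst (p : ZFSet.{u}) : ZFSet.{u} :=
  (⋃₀ ⋃₀ p : ZFSet).sep fun z => ∃ a ∈ (⋃₀ p : ZFSet), ∃ b ∈ (⋃₀ p : ZFSet), p = pair a b ∧ z ∈ a

/-- The second component of a Kuratowski pair. -/
noncomputable def kpairSnd (p : ZFSet.{u}) : ZFSet.{u} :=
  (⋃₀ ⋃₀ p : ZFSet).sep fun z => ∃ a ∈ (⋃₀ p : ZFSet), ∃ b ∈ (⋃₀ p : ZFSet), p = pair a b ∧ z ∈ b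

theorem left_mem_sUnion_pair (a b : ZFSet.{u}) : a ∈ (⋃₀ (pair a b) : ZFSet) := by
  simp [pair]

theorem right_mem_sUnion_pair (a b : ZFSet.{u}) : b ∈ (⋃₀ (pair a b) : ZFSet) := by
  simp [pair]

@[simp] theorem kpairFst_pair (a b : ZFSet.{u}) : kpairFst (pair a b) = a := by
  ext z
  simp only [kpairFst, mem_sep, mem_sUnion, pair_inj]
  grind [left_mem_sUnion_pair, right_mem_sUnion_pair, mem_sUnion]

@[simp] theorem kpairSnd_pair (a b : ZFSet.{u}) : kpairSnd (pair a b) = b := by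
  ext z
  simp only [kpairSnd, mem_sep, mem_sUnion, pair_inj]
  grind [left_mem_sUnion_pair, right_mem_sUnion_pair, mem_sUnion]

namespace IsRudimentary

variable {n : ℕ} {f g : (Fin n → ZFSet.{u}) → ZFSet.{u}}

theorem fst (hf : IsRudimentary n f) : IsRudimentary n (fun v => kpairFst (f v)) := by
  suffices h : IsRudimentary 1 (fun v => kpairFst (v 0)) from h.comp (H := fun _ => f) fun _ => hf
  unfold kpairFst
  apply_rules [proj, sep, sUnion, kpair, IsRudimentaryRel.exists_mem, IsRudimentaryRel.and,
    IsRudimentaryRel.eq, IsRudimentaryRel.mem]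

theorem snd (hf : IsRudimentary n f) : IsRudimentary n (fun v => kpairSnd (f v)) := by
  suffices h : IsRudimentary 1 (fun v => kpairSnd (v 0)) from h.comp (H := fun _ => f) fun _ => hf
  unfold kpairSnd
  apply_rules [proj, sep, sUnion, kpair, IsRudimentaryRel.exists_mem, IsRudimentaryRel.and,
    IsRudimentaryRel.eq, IsRudimentaryRel.mem]

open Classical in
theorem ite {P : (Fin n → ZFSet.{u}) → Prop} (hP : IsRudimentaryRel n P) (hf : IsRudimentary n f)
    (hg : IsRudimentary n g) : IsRudimentary n (fun v => if P v then f v else g v) := by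
  have hcases : IsRudimentary n
      (fun v => (f v).sep (fun _ => P v) ∪ (g v).sep fun _ => ¬ P v) :=
    (hf.sep (P := fun _ v => P v) (hP.comp fun i => proj i.succ)).union'
      (hg.sep (P := fun _ v => ¬ P v) (hP.not.comp fun i => proj i.succ))
  refine hcases.congr fun v => ?_
  ext z
  split_ifs with h <;> simp [h]

end IsRudimentary

theorem pair_mem_funGraph {X Y : ZFSet.{u}} {F : X → Y} {a b : ZFSet.{u}} :
    pair a b ∈ funGraph F ↔ ∃ h : a ∈ X, (F ⟨a, h⟩ : ZFSet.{u}) = b := by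
  simp only [funGraph, mem_sep, pair_mem_prod, pair_inj]
  constructor
  · rintro ⟨-, a', rfl, rfl⟩
    exact ⟨a'.2, rfl⟩
  · rintro ⟨h, rfl⟩
    exact ⟨⟨h, (F ⟨a, h⟩).2⟩, ⟨a, h⟩, rfl, rfl⟩

namespace RudClosed

variable {M : ZFSet.{u}}

theorem mem₂ (hM : RudClosed M) {F : (Fin 2 → ZFSet.{u}) → ZFSet.{u}} (hF : IsRudimentary 2 F)
    {a b : ZFSet.{u}} (ha : a ∈ M) (hb : b ∈ M) : F ![a, b] ∈ M :=
  hM 2 F hF _ (by simp [Fin.forall_fin_succ, ha, hb])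

theorem pair_mem (hM : RudClosed M) {a b : ZFSet.{u}} (ha : a ∈ M) (hb : b ∈ M) :
    pair a b ∈ M :=
  hM.mem₂ (.kpair (.proj 0) (.proj 1)) ha hb

theorem insert_mem (hM : RudClosed M) {a b : ZFSet.{u}} (ha : a ∈ M) (hb : b ∈ M) :
    insert a b ∈ M :=
  hM.mem₂ (.insert (.proj 0) (.proj 1)) ha hb

theorem inter_mem (hM : RudClosed M) {a b : ZFSet.{u}} (ha : a ∈ M) (hb : b ∈ M) :
    a ∩ b ∈ M :=
  hM.mem₂ (.inter (.proj 0) (.proj 1)) ha hb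

theorem prod_mem (hM : RudClosed M) {a b : ZFSet.{u}} (ha : a ∈ M) (hb : b ∈ M) :
    a.prod b ∈ M :=
  hM.mem₂ (.prod (.proj 0) (.proj 1)) ha hb

theorem sep_mem (hM : RudClosed M) {n : ℕ} {P : ZFSet.{u} → (Fin n → ZFSet.{u}) → Prop}
    (hP : IsRudimentaryRel (n + 1) (fun w => P (w 0) (Fin.tail w))) {x : ZFSet.{u}} (hx : x ∈ M)
    {c : Fin n → ZFSet.{u}} (hc : ∀ i, c i ∈ M) : (x.sep fun z => P z c) ∈ M := by
  have hsep : IsRudimentary (n + 1) (fun w => (w 0).sep fun z => P z (Fin.tail w)) :=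
    .sep (.proj 0) (hP.comp (H := Fin.cons (fun w => w 0) fun i w => w i.succ.succ)
      (Fin.cases (.proj 0) fun i => .proj i.succ.succ))
  exact hM _ _ hsep (Fin.cons x c) (Fin.cases hx hc)

theorem funGraph_mem (hM : RudClosed M) {n : ℕ}
    {P : ZFSet.{u} → ZFSet.{u} → (Fin n → ZFSet.{u}) → Prop}
    (hP : IsRudimentaryRel (n + 2) (fun w => P (w 0) (w 1) (Fin.tail (Fin.tail w))))
    {X Y : ZFSet.{u}} (hX : X ∈ M) (hY : Y ∈ M) {c : Fin n → ZFSet.{u}} (hc : ∀ i, c i ∈ M)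
    {F : X → Y} (hF : ∀ (a : X) (b : Y), (F a : ZFSet.{u}) = b ↔ P a b c) : funGraph F ∈ M := by
  have hfst_snd : IsRudimentaryRel (n + 1)
      (fun w => P (kpairFst (w 0)) (kpairSnd (w 0)) (Fin.tail w)) :=
    hP.comp (H := Fin.cons (fun w => kpairFst (w 0))
        (Fin.cons (fun w => kpairSnd (w 0)) fun i w => w i.succ))
      (Fin.cases (.fst (.proj 0)) (Fin.cases (.snd (.proj 0)) fun i => .proj i.succ))
  convert hM.sep_mem (P := fun p c => P (kpairFst p) (kpairSnd p) c) hfst_snd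
    (hM.prod_mem hX hY) hc using 1
  ext p
  simp only [funGraph, mem_sep, and_congr_right_iff, mem_prod]
  rintro ⟨a, ha, b, hb, rfl⟩
  simp only [kpairFst_pair, kpairSnd_pair, ← hF ⟨a, ha⟩ ⟨b, hb⟩, pair_inj]
  grind

theorem funGraph_symm_mem (hM : RudClosed M) {X Y : ZFSet.{u}} (hX : X ∈ M) (hY : Y ∈ M)
    {e : X ≃ Y} (he : funGraph e ∈ M) : funGraph e.symm ∈ M := by
  refine hM.funGraph_mem (P := fun b a c => pair a b ∈ c 0) (n := 1) (c := ![funGraph e])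
    (.mem (.kpair (.proj 1) (.proj 0)) (.proj 2)) hY hX (by simpa) fun b a => ?_
  simp only [Matrix.cons_val_fin_one, pair_mem_funGraph, Subtype.coe_eta, Subtype.coe_inj,
    SetLike.coe_mem, exists_true_left, Equiv.symm_apply_eq]
  exact eq_comm

theorem funGraph_trans_mem (hM : RudClosed M) {X Y Z : ZFSet.{u}} (hX : X ∈ M) (hY : Y ∈ M)
    (hZ : Z ∈ M) {e : X ≃ Y} {f : Y ≃ Z} (he : funGraph e ∈ M) (hf : funGraph f ∈ M) :
    funGraph (e.trans f) ∈ M := by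
  refine hM.funGraph_mem (n := 3)
    (P := fun a b c => ∃ y ∈ c 0, pair a y ∈ c 1 ∧ pair y b ∈ c 2)
    (c := ![Y, funGraph e, funGraph f]) ?_ hX hZ
    (by simp [Fin.forall_fin_succ, hY, he, hf]) fun a b => ?_
  · exact .exists_mem (.proj 2)
      (.and (.mem (.kpair (.proj 1) (.proj 0)) (.proj 4))
        (.mem (.kpair (.proj 0) (.proj 2)) (.proj 5)))
  · simp [pair_mem_funGraph]

theorem mem_of_finite (hM : RudClosed M) (h0 : ∅ ∈ M) {x : ZFSet.{u}}
    (hx : (x : Set ZFSet.{u}).Finite) (hxM : x ⊆ M) : x ∈ M := by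
  suffices H : ∀ s : Set ZFSet.{u}, s.Finite → s ⊆ M → ∃ z ∈ M, (z : Set ZFSet.{u}) = s by
    obtain ⟨z, hz, hzx⟩ := H x hx fun a ha => hxM ha
    rwa [← SetLike.coe_injective hzx]
  intro s hs
  induction s, hs using Set.Finite.induction_on with
  | empty => exact fun _ => ⟨∅, h0, by simp⟩
  | @insert a s _ _ ih =>
    intro hsM
    obtain ⟨z, hz, rfl⟩ := ih fun b hb => hsM (Set.mem_insert_of_mem _ hb)
    exact ⟨insert a z, hM.insert_mem (hsM (Set.mem_insert _ _)) hz, by simp⟩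

theorem funGraph_mem_of_finite (hM : RudClosed M) (h0 : ∅ ∈ M) {X Y : ZFSet.{u}}
    (hX : (X : Set ZFSet.{u}).Finite) (hXM : X ⊆ M) (hYM : Y ⊆ M) (F : X → Y) :
    funGraph F ∈ M := by
  have : Finite X := hX
  refine hM.mem_of_finite h0
    ((Set.finite_range fun a : X => pair a (F a)).subset fun p hp => ?_) fun p hp => ?_
  all_goals obtain ⟨a, rfl⟩ := (mem_sep.1 hp).2
  · exact ⟨a, rfl⟩
  · exact hM.pair_mem (hXM a.2) (hYM (F a).2)

end RudClosed

/-! ### Rudimentary closures of transitive sets -/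

/-- The `i`-th component of a tuple `(a₀, (a₁, (a₂, …)))` coded by iterated pairs. -/
noncomputable def component (i : ℕ) (p : ZFSet.{u}) : ZFSet.{u} :=
  kpairFst (kpairSnd^[i] p)

theorem IsRudimentary.component {n : ℕ} {f : (Fin n → ZFSet.{u}) → ZFSet.{u}}
    (hf : IsRudimentary n f) (i : ℕ) : IsRudimentary n (fun v => component i (f v)) := by
  refine IsRudimentary.fst ?_
  induction i with
  | zero => exact hf
  | succ i ih => simpa only [Function.iterate_succ_apply'] using ih.snd

theorem RudClosed.exists_component_eq {M : ZFSet.{u}} (hM : RudClosed M) (h0 : ∅ ∈ M) {n : ℕ}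
    (a : Fin n → ZFSet.{u}) (ha : ∀ i, a i ∈ M) : ∃ p ∈ M, ∀ i : Fin n, component i p = a i := by
  induction n with
  | zero => exact ⟨∅, h0, fun i => i.elim0⟩
  | succ n ih =>
    obtain ⟨p, hp, h⟩ := ih (Fin.tail a) fun i => ha i.succ
    refine ⟨pair (a 0) p, hM.pair_mem (ha 0) hp, Fin.cases (by simp [component]) fun i => ?_⟩
    simpa [component, Function.iterate_succ_apply, Fin.tail] using h i

/-- `S` is covered by the values at the elements of `M` of a rudimentary function that may also
refer to `M` itself. -/
def IsParametrized (M : ZFSet.{u}) (S : Set ZFSet.{u}) : Prop :=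
  ∃ F : ZFSet.{u} → ZFSet.{u} → ZFSet.{u},
    IsRudimentary 2 (fun v => F (v 0) (v 1)) ∧ Set.SurjOn (F M) M S

namespace IsParametrized

variable {M : ZFSet.{u}} {S T : Set ZFSet.{u}}

theorem mono (hT : IsParametrized M T) (hST : S ⊆ T) : IsParametrized M S :=
  let ⟨F, hF, hFT⟩ := hT
  ⟨F, hF, hFT.mono subset_rfl hST⟩

theorem empty : IsParametrized M ∅ :=
  ⟨fun _ p => p, .proj 1, Set.surjOn_empty _ _⟩

theorem self : IsParametrized M M :=
  ⟨fun _ p => p, .proj 1, Set.surjOn_id _⟩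

theorem singleton (h0 : ∅ ∈ M) : IsParametrized M {M} :=
  ⟨fun m _ => m, .proj 0, by rintro _ rfl; exact ⟨∅, h0, rfl⟩⟩

open Classical in
theorem union (hM : RudClosed M) (h0 : ∅ ∈ M) (hS : IsParametrized M S)
    (hT : IsParametrized M T) : IsParametrized M (S ∪ T) := by
  obtain ⟨F, hF, hFS⟩ := hS
  obtain ⟨G, hG, hGT⟩ := hT
  -- The first component of the parameter chooses between the two parametrizations.
  refine ⟨fun m p => if (kpairFst p).Nonempty then F m (kpairSnd p) else G m (kpairSnd p),
    .ite ⟨_, .fst (.proj 1), fun _ => Iff.rfl⟩ (hF.comp₂ (.proj 0) (.snd (.proj 1)))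
      (hG.comp₂ (.proj 0) (.snd (.proj 1))), ?_⟩
  rintro y (hy | hy)
  · obtain ⟨p, hp, rfl⟩ := hFS hy
    exact ⟨pair {∅} p, hM.pair_mem (by simpa using hM.insert_mem h0 h0) hp,
      by simp [singleton_nonempty]⟩
  · obtain ⟨p, hp, rfl⟩ := hGT hy
    exact ⟨pair ∅ p, hM.pair_mem h0 hp, by simp [ZFSet.not_nonempty_empty]⟩

theorem image_pi (hM : RudClosed M) (h0 : ∅ ∈ M) (hS : IsParametrized M S) {n : ℕ}
    {F : (Fin n → ZFSet.{u}) → ZFSet.{u}} (hF : IsRudimentary n F) :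
    IsParametrized M (F '' Set.univ.pi fun _ => S) := by
  obtain ⟨G, hG, hGS⟩ := hS
  refine ⟨fun m p => F fun i => G m (component i p),
    hF.comp fun i => hG.comp₂ (.proj 0) (.component (.proj 1) i), ?_⟩
  rintro _ ⟨v, hv, rfl⟩
  choose a ha hav using fun i => hGS (hv i trivial)
  obtain ⟨p, hp, h⟩ := hM.exists_component_eq h0 a ha
  exact ⟨p, hp, by simp [h, hav]⟩

end IsParametrized

/-- A layer over `M` is a transitive family of sets parametrized by the elements of `M`. Layers
exhaust the rudimentary closure of a transitive set `M`. -/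
structure IsLayer (M : ZFSet.{u}) (T : Set ZFSet.{u}) : Prop where
  subset_of_mem : ∀ x ∈ T, (x : Set ZFSet.{u}) ⊆ T
  isParametrized : IsParametrized M T

namespace IsLayer

variable {M : ZFSet.{u}} {T U : Set ZFSet.{u}}

theorem empty : IsLayer M ∅ :=
  ⟨by simp, .empty⟩

theorem self (hMt : M.IsTransitive) : IsLayer M M :=
  ⟨fun x hx _ hz => hMt x hx hz, .self⟩

theorem union (hM : RudClosed M) (h0 : ∅ ∈ M) (hT : IsLayer M T) (hU : IsLayer M U) :
    IsLayer M (T ∪ U) where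
  subset_of_mem := by
    rintro x (hx | hx)
    · exact Set.subset_union_of_subset_left (hT.subset_of_mem x hx) U
    · exact Set.subset_union_of_subset_right (hU.subset_of_mem x hx) T
  isParametrized := .union hM h0 hT.isParametrized hU.isParametrized

theorem iUnion (hM : RudClosed M) (h0 : ∅ ∈ M) {n : ℕ} {T : Fin n → Set ZFSet.{u}}
    (hT : ∀ i, IsLayer M (T i)) : IsLayer M (⋃ i, T i) := by
  rw [← Set.iSup_eq_iUnion, ← Finset.sup_univ_eq_iSup]
  exact Finset.sup_induction empty (fun _ h _ h' => h.union hM h0 h') fun i _ => hT i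

theorem adjoin (hM : RudClosed M) (h0 : ∅ ∈ M) (hU : IsLayer M U) (hT : IsParametrized M T)
    {n : ℕ} {F : (Fin n → ZFSet.{u}) → ZFSet.{u}} (hF : IsRudimentary n F)
    (hFU : ∀ v, (∀ i, v i ∈ T) → (F v : Set ZFSet.{u}) ⊆ U) :
    IsLayer M (U ∪ F '' Set.univ.pi fun _ => T) where
  subset_of_mem := by
    rintro x (hx | ⟨v, hv, rfl⟩)
    · exact Set.subset_union_of_subset_left (hU.subset_of_mem x hx) _
    · exact Set.subset_union_of_subset_left (hFU v fun i => hv i trivial) _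
  isParametrized := .union hM h0 hU.isParametrized (.image_pi hM h0 hT hF)

end IsLayer

theorem IsRudimentary.exists_isLayer {M : ZFSet.{u}} (hM : RudClosed M) (h0 : ∅ ∈ M) {n : ℕ}
    {F : (Fin n → ZFSet.{u}) → ZFSet.{u}} (hF : IsRudimentary n F) {T : Set ZFSet.{u}}
    (hT : IsLayer M T) : ∃ U, IsLayer M U ∧ ∀ v, (∀ i, v i ∈ T) → F v ∈ U := by
  have hadjoin {n : ℕ} {F : (Fin n → ZFSet.{u}) → ZFSet.{u}} (hF : IsRudimentary n F)
      {T U : Set ZFSet.{u}} (hT : IsLayer M T) (hU : IsLayer M U)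
      (hFU : ∀ v, (∀ i, v i ∈ T) → (F v : Set ZFSet.{u}) ⊆ U) :
      ∃ U, IsLayer M U ∧ ∀ v, (∀ i, v i ∈ T) → F v ∈ U :=
    ⟨_, hU.adjoin hM h0 hT.isParametrized hF hFU,
      fun v hv => Or.inr (Set.mem_image_of_mem F fun i _ => hv i)⟩
  induction hF generalizing T with
  | proj i => exact ⟨T, hT, fun v hv => hv i⟩
  | pair i j => exact hadjoin (.pair i j) hT hT fun v hv => by simp [Set.pair_subset_iff, hv]
  | diff i j =>
    exact hadjoin (.diff i j) hT hT fun v hv z hz =>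
      hT.subset_of_mem _ (hv i) (mem_sdiff.1 hz).1
  | comp _ _ ihG ihH =>
    choose U hU hHU using fun i => ihH i hT
    obtain ⟨V, hV, hGV⟩ := ihG (IsLayer.iUnion hM h0 hU)
    exact ⟨V, hV, fun v hv => hGV _ fun i => Set.mem_iUnion_of_mem i (hHU i v hv)⟩
  | @union n H hH ih =>
    obtain ⟨U, hU, hHU⟩ := ih hT
    refine hadjoin (.union hH) hT hU fun v hv z hz => ?_
    obtain ⟨y, hzy⟩ := mem_iUnion.1 hz
    exact hU.subset_of_mem _ (hHU _ (Fin.cases (hT.subset_of_mem _ (hv 0) y.2) (hv ·.succ))) hzy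

section RudClosure

variable {M : ZFSet.{u}}

theorem rudClosed_rudClosure : RudClosed (rudClosure M) :=
  (rudClosure_spec M).1.2.2

theorem subset_rudClosure : M ⊆ rudClosure M :=
  (rudClosure_spec M).1.1

theorem self_mem_rudClosure : M ∈ rudClosure M :=
  (rudClosure_spec M).1.2.1

theorem IsParametrized.subset_rudClosure {S : Set ZFSet.{u}} (hS : IsParametrized M S) :
    S ⊆ rudClosure M := by
  obtain ⟨F, hF, hFS⟩ := hS
  refine hFS.trans ?_
  rintro _ ⟨p, hp, rfl⟩
  exact rudClosed_rudClosure.mem₂ hF self_mem_rudClosure ((rudClosure_spec M).1.1 hp)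

theorem exists_isLayer_of_mem_rudClosure (hM : RudClosed M) (h0 : ∅ ∈ M) (hMt : M.IsTransitive)
    {x : ZFSet.{u}} (hx : x ∈ rudClosure M) : ∃ T, IsLayer M T ∧ x ∈ T := by
  let C := (rudClosure M).sep fun x => ∃ T, IsLayer M T ∧ x ∈ T
  have hMC : M ⊆ C := fun a ha => mem_sep.2 ⟨subset_rudClosure ha, M, .self hMt, ha⟩
  have hM_mem : M ∈ C := by
    refine mem_sep.2 ⟨self_mem_rudClosure, M ∪ {M}, ⟨?_, .union hM h0 .self (.singleton h0)⟩,
      by simp⟩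
    rintro x (hx | rfl)
    · exact Set.subset_union_of_subset_left (hMt x hx) _
    · exact Set.subset_union_left
  have hC : RudClosed C := by
    intro n F hF v hv
    choose hvM T hT hvT using fun i => mem_sep.1 (hv i)
    obtain ⟨U, hU, hFU⟩ := hF.exists_isLayer hM h0 (IsLayer.iUnion hM h0 hT)
    exact mem_sep.2 ⟨rudClosed_rudClosure n F hF v hvM, U, hU,
      hFU v fun i => Set.mem_iUnion_of_mem i (hvT i)⟩
  exact (mem_sep.1 ((rudClosure_spec M).2 C hMC hM_mem hC hx)).2

theorem isTransitive_rudClosure (hM : RudClosed M) (h0 : ∅ ∈ M) (hMt : M.IsTransitive) :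
    (rudClosure M).IsTransitive := by
  intro x hx y hy
  obtain ⟨T, hT, hxT⟩ := exists_isLayer_of_mem_rudClosure hM h0 hMt hx
  exact hT.isParametrized.subset_rudClosure (hT.subset_of_mem x hxT hy)

theorem isParametrized_of_mem_rudClosure (hM : RudClosed M) (h0 : ∅ ∈ M) (hMt : M.IsTransitive)
    {x : ZFSet.{u}} (hx : x ∈ rudClosure M) : IsParametrized M x := by
  obtain ⟨T, hT, hxT⟩ := exists_isLayer_of_mem_rudClosure hM h0 hMt hx
  exact hT.isParametrized.mono (hT.subset_of_mem x hxT)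

end RudClosure

/-! ### Hereditarily finite sets -/

theorem rudClosed_vonNeumann_omega0 : RudClosed (vonNeumann Ordinal.omega0.{u}) := by
  intro n F hF v hv
  obtain ⟨k, hk⟩ := hF.rank_le
  choose m hm using fun i => Ordinal.lt_omega0.1 (mem_vonNeumann.1 (hv i))
  refine mem_vonNeumann.2 ((hk (Finset.univ.sup m : ℕ) v fun i => ?_).trans_lt ?_)
  · rw [hm]
    exact_mod_cast Finset.le_sup (Finset.mem_univ i)
  · exact_mod_cast Ordinal.natCast_lt_omega0 (Finset.univ.sup m + k)

theorem finite_of_mem_vonNeumann_omega0 {x : ZFSet.{u}} (hx : x ∈ vonNeumann Ordinal.omega0) :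
    (x : Set ZFSet.{u}).Finite := by
  have hcard : x.card < Cardinal.aleph0 := by
    calc x.card ≤ (vonNeumann x.rank).card := card_mono (subset_vonNeumann_self x)
      _ = Cardinal.preBeth x.rank := card_vonNeumann _
      _ < Cardinal.preBeth Ordinal.omega0 := Cardinal.preBeth_strictMono (mem_vonNeumann.1 hx)
      _ = Cardinal.aleph0 := Cardinal.preBeth_omega
  have : Cardinal.mk x < Cardinal.aleph0 := by rwa [cardinalMk_coe_sort, Cardinal.lift_lt_aleph0]
  exact Cardinal.lt_aleph0_iff_finite.1 this

theorem rudClosed_J1 : RudClosed J1.{u} :=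
  rudClosed_rudClosure

theorem empty_mem_J1 : ∅ ∈ J1.{u} :=
  self_mem_rudClosure

theorem J1_eq_vonNeumann : J1.{u} = vonNeumann Ordinal.omega0 := by
  apply SetLike.coe_injective
  apply Set.Subset.antisymm
  · exact (rudClosure_spec _).2 _ (empty_subset _) (mem_vonNeumann.2 (by simp))
      rudClosed_vonNeumann_omega0
  · intro x hx
    induction x using inductionOn with
    | h x ih =>
    exact rudClosed_J1.mem_of_finite empty_mem_J1 (finite_of_mem_vonNeumann_omega0 hx)
      fun a ha => ih a ha (isTransitive_vonNeumann _ _ hx ha)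

theorem isTransitive_J1 : J1.{u}.IsTransitive :=
  J1_eq_vonNeumann ▸ isTransitive_vonNeumann _

theorem mem_J1_iff {x : ZFSet.{u}} : x ∈ J1 ↔ (x : Set ZFSet.{u}).Finite ∧ x ⊆ J1 :=
  ⟨fun hx => ⟨finite_of_mem_vonNeumann_omega0 (J1_eq_vonNeumann ▸ hx), isTransitive_J1 x hx⟩,
    fun ⟨hx, hxJ⟩ => rudClosed_J1.mem_of_finite empty_mem_J1 hx hxJ⟩

theorem exists_isTransitive_mem_J1 {x y : ZFSet.{u}} (hx : x ∈ J1) (hy : y ∈ J1) :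
    ∃ t ∈ J1, t.IsTransitive ∧ x ∈ t ∧ y ∈ t := by
  rw [J1_eq_vonNeumann] at hx hy ⊢
  refine ⟨vonNeumann (Order.succ (max x.rank y.rank)), vonNeumann_mem_of_lt ?_,
    isTransitive_vonNeumann _, mem_vonNeumann.2 (by simp), mem_vonNeumann.2 (by simp)⟩
  exact Ordinal.isSuccLimit_omega0.succ_lt (max_lt (mem_vonNeumann.1 hx) (mem_vonNeumann.1 hy))

theorem rudClosed_J2 : RudClosed J2.{u} :=
  rudClosed_rudClosure

theorem J1_mem_J2 : J1.{u} ∈ J2 :=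
  self_mem_rudClosure

theorem J1_subset_J2 : J1.{u} ⊆ J2 :=
  subset_rudClosure

theorem isTransitive_J2 : J2.{u}.IsTransitive :=
  isTransitive_rudClosure rudClosed_J1 empty_mem_J1 isTransitive_J1

/-! ### Natural numbers -/

/-- The von Neumann natural number `n`. -/
noncomputable def natSet (n : ℕ) : ZFSet.{u} :=
  (n : Ordinal.{u}).toZFSet

theorem natSet_succ (n : ℕ) : natSet.{u} (n + 1) = insert (natSet n) (natSet n) := by
  simp [natSet, Ordinal.toZFSet_add_one]

theorem natSet_injective : Function.Injective natSet.{u} :=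
  Ordinal.toZFSet_injective.comp Nat.cast_injective

theorem coe_natSet (n : ℕ) : (natSet n : Set ZFSet.{u}) = natSet '' Set.Iio n := by
  ext x
  simp only [natSet, SetLike.mem_coe, Ordinal.mem_toZFSet_iff, Set.mem_image, Set.mem_Iio]
  constructor
  · rintro ⟨a, ha, rfl⟩
    obtain ⟨m, rfl⟩ := Ordinal.lt_omega0.1 (ha.trans (Ordinal.natCast_lt_omega0 n))
    exact ⟨m, Nat.cast_lt.1 ha, rfl⟩
  · rintro ⟨m, hm, rfl⟩
    exact ⟨m, Nat.cast_lt.2 hm, rfl⟩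

theorem ncard_natSet (n : ℕ) : (natSet n : Set ZFSet.{u}).ncard = n := by
  rw [coe_natSet, Set.ncard_image_of_injective _ natSet_injective, Set.ncard_Iio_nat]

theorem natSet_mem_J1 (n : ℕ) : natSet.{u} n ∈ J1 := by
  rw [J1_eq_vonNeumann, mem_vonNeumann, natSet, Ordinal.rank_toZFSet]
  exact Ordinal.natCast_lt_omega0 n

theorem mem_omega_iff {x : ZFSet.{u}} : x ∈ (omega : ZFSet.{u}) ↔ ∃ n, x = natSet n := by
  have h : ∀ n, mk (PSet.ofNat n) = natSet.{u} n := by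
    intro n
    induction n with
    | zero => rw [natSet, Nat.cast_zero, Ordinal.toZFSet_zero]; rfl
    | succ n ih => rw [natSet_succ, ← ih]; rfl
  constructor
  · induction x using Quotient.inductionOn with
    | h x =>
    rintro ⟨⟨n⟩, hn⟩
    exact ⟨n, by rw [← h]; exact sound hn⟩
  · rintro ⟨n, rfl⟩
    induction n with
    | zero => simp [natSet]
    | succ n ih => rw [natSet_succ]; exact omega_succ ih

theorem mem_omega_iff_isOrdinal {x : ZFSet.{u}} :
    x ∈ (omega : ZFSet.{u}) ↔ x ∈ J1 ∧ x.IsOrdinal := by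
  rw [mem_omega_iff]
  constructor
  · rintro ⟨n, rfl⟩
    exact ⟨natSet_mem_J1 n, isOrdinal_toZFSet _⟩
  · rintro ⟨hx, hord⟩
    rw [J1_eq_vonNeumann, mem_vonNeumann] at hx
    obtain ⟨n, hn⟩ := Ordinal.lt_omega0.1 hx
    exact ⟨n, by rw [natSet, ← hn, hord.toZFSet_rank_eq]⟩

theorem omega_mem_J2 : (omega : ZFSet.{u}) ∈ J2 := by
  have hord : IsRudimentaryRel 1 fun w : Fin 1 → ZFSet.{u} => (w 0).IsOrdinal := by
    simp only [isOrdinal_iff_forall_mem_isTransitive]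
    exact .and (.isTransitive (.proj 0)) (.forall_mem (.proj 0) (.isTransitive (.proj 0)))
  convert rudClosed_J2.sep_mem (P := fun x _ => x.IsOrdinal) hord J1_mem_J2 (c := ![]) (by simp)
  ext x
  rw [mem_sep, mem_omega_iff_isOrdinal]

/-! ### Ackermann's ordering of the hereditarily finite sets -/

theorem lt_iff_exists_testBit {m n : ℕ} :
    m < n ↔ ∃ i, n.testBit i ∧ ¬ m.testBit i ∧ ∀ j, i < j → (m.testBit j ↔ n.testBit j) := by
  constructor
  · intro hmn
    obtain ⟨i, hi, hij⟩ := Nat.exists_most_significant_bit (Nat.xor_ne_zero_iff.2 hmn.ne)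
    have hagree : ∀ j, i < j → m.testBit j = n.testBit j := by simpa using hij
    have hne : m.testBit i ≠ n.testBit i := by simpa using hi
    have hni : n.testBit i = true := by
      by_contra hni
      have hmi : m.testBit i = true := by grind
      exact hmn.not_gt (Nat.lt_of_testBit i (by simpa using hni) hmi fun j hj => (hagree j hj).symm)
    exact ⟨i, hni, by simpa [hni] using hne, fun j hj => by rw [hagree j hj]⟩
  · rintro ⟨i, hni, hmi, hagree⟩
    exact Nat.lt_of_testBit i (by simpa using hmi) hni fun j hj => Bool.eq_iff_iff.2 (hagree j hj)

/-- Ackermann's code `∑ 2 ^ code y`, over `y ∈ x`, of a hereditarily finite set `x`. Codes of equal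
value are counted once, and the junk value `0` is taken if infinitely many codes occur. -/
noncomputable def code (x : ZFSet.{u}) : ℕ :=
  ∑ᶠ i ∈ Set.range fun y : x => code y.1, 2 ^ i
termination_by x
decreasing_by exact y.2

theorem testBit_code_iff_exists {x : ZFSet.{u}} (hx : x ∈ J1) {i : ℕ} :
    (code x).testBit i ↔ ∃ y ∈ x, code y = i := by
  have hfin : (Set.range fun y : x => code y.1).Finite := by
    have := (mem_J1_iff.1 hx).1.to_subtype
    exact Set.finite_range (ι := (x : Set ZFSet.{u})) fun y => code y.1
  rw [code, finsum_mem_eq_finite_toFinset_sum _ hfin, ← Nat.mem_bitIndices, ← List.mem_toFinset,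
    Finset.toFinset_bitIndices_sum_two_pow]
  simp

theorem code_injOn : Set.InjOn code (J1 : Set ZFSet.{u}) := by
  intro x hx y hy hxy
  induction x using inductionOn generalizing y with
  | h x ih =>
  have hcodes : ∀ i, (∃ z ∈ x, code z = i) ↔ ∃ w ∈ y, code w = i := fun i => by
    rw [← testBit_code_iff_exists hx, ← testBit_code_iff_exists hy, hxy]
  have heq : ∀ z ∈ x, ∀ w ∈ y, code z = code w → z = w := fun z hz w hw =>
    ih z hz (isTransitive_J1 _ hx hz) (isTransitive_J1 _ hy hw)
  ext z
  constructor
  · intro hz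
    obtain ⟨w, hw, hwz⟩ := (hcodes _).1 ⟨z, hz, rfl⟩
    rwa [heq z hz w hw hwz.symm]
  · intro hz
    obtain ⟨w, hw, hwz⟩ := (hcodes _).2 ⟨z, hz, rfl⟩
    rwa [← heq w hw z hz hwz]

theorem testBit_code_code_iff {x y : ZFSet.{u}} (hx : x ∈ J1) (hy : y ∈ J1) :
    (code x).testBit (code y) ↔ y ∈ x := by
  rw [testBit_code_iff_exists hx]
  refine ⟨fun ⟨z, hz, hzy⟩ => ?_, fun hyx => ⟨y, hyx, rfl⟩⟩
  rwa [← code_injOn (isTransitive_J1 _ hx hz) hy hzy]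

theorem code_lt_code_iff {x y : ZFSet.{u}} (hx : x ∈ J1) (hy : y ∈ J1) :
    code x < code y ↔ ∃ z ∈ y, z ∉ x ∧ ∀ w ∈ x ∪ y, code z < code w → (w ∈ x ↔ w ∈ y) := by
  rw [lt_iff_exists_testBit]
  constructor
  · rintro ⟨i, hiy, hix, hagree⟩
    obtain ⟨z, hz, rfl⟩ := (testBit_code_iff_exists hy).1 hiy
    rw [testBit_code_code_iff hx (isTransitive_J1 _ hy hz)] at hix
    refine ⟨z, hz, hix, fun w hw hzw => ?_⟩
    have hwJ : w ∈ J1 := (mem_union.1 hw).elim (isTransitive_J1 _ hx ·) (isTransitive_J1 _ hy ·)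
    rw [← testBit_code_code_iff hx hwJ, ← testBit_code_code_iff hy hwJ]
    exact hagree _ hzw
  · rintro ⟨z, hz, hzx, hagree⟩
    have hzJ := isTransitive_J1 _ hy hz
    refine ⟨code z, (testBit_code_code_iff hy hzJ).2 hz, mt (testBit_code_code_iff hx hzJ).1 hzx,
      fun i hzi => ?_⟩
    rw [testBit_code_iff_exists hx, testBit_code_iff_exists hy]
    grind [mem_union]

/-- `R` satisfies, for the elements of `t`, the recursive condition which characterises Ackermann's
ordering `code a < code b`. It is used as a definition of this ordering by finite attempts. -/
def IsAckermannRel (R t : ZFSet.{u}) : Prop :=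
  ∀ a ∈ t, ∀ b ∈ t, (pair a b ∈ R ↔
    ∃ z ∈ b, z ∉ a ∧ ∀ w ∈ a ∪ b, pair z w ∈ R → (w ∈ a ↔ w ∈ b))

theorem IsAckermannRel.pair_mem_iff {R t : ZFSet.{u}} (hR : IsAckermannRel R t)
    (ht : t.IsTransitive) (htJ : t ⊆ J1) {a b : ZFSet.{u}} (ha : a ∈ t) (hb : b ∈ t) :
    pair a b ∈ R ↔ code a < code b := by
  induction hr : max a.rank b.rank using WellFoundedLT.induction generalizing a b with
  | ind r ih =>
  subst hr
  rw [hR a ha b hb, code_lt_code_iff (htJ ha) (htJ hb)]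
  refine exists_congr fun z => and_congr_right fun hz => and_congr_right fun _ =>
    forall₂_congr fun w hw => ?_
  have hw' : w ∈ t ∧ w.rank < max a.rank b.rank := by
    rcases mem_union.1 hw with hw | hw
    · exact ⟨ht _ ha hw, lt_max_of_lt_left (rank_lt_of_mem hw)⟩
    · exact ⟨ht _ hb hw, lt_max_of_lt_right (rank_lt_of_mem hw)⟩
  rw [ih _ (max_lt (lt_max_of_lt_right (rank_lt_of_mem hz)) hw'.2) (ht _ hb hz) hw'.1 rfl]

theorem exists_isAckermannRel {t : ZFSet.{u}} (ht : t.IsTransitive) (htJ : t ∈ J1) :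
    ∃ R ∈ J1, IsAckermannRel R t := by
  have hprod := mem_J1_iff.1 (rudClosed_J1.prod_mem htJ htJ)
  let R := (t.prod t).sep fun p => code (kpairFst p) < code (kpairSnd p)
  have hRprod : R ⊆ t.prod t := sep_subset
  have hmem : ∀ a ∈ t, ∀ b ∈ t, (pair a b ∈ R ↔ code a < code b) := by
    intro a ha b hb
    simp [R, ha, hb]
  refine ⟨R, mem_J1_iff.2 ⟨hprod.1.subset hRprod, hRprod.trans hprod.2⟩, fun a ha b hb => ?_⟩
  rw [hmem a ha b hb, code_lt_code_iff (isTransitive_J1 _ htJ ha) (isTransitive_J1 _ htJ hb)]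
  refine exists_congr fun z => and_congr_right fun hz => and_congr_right fun _ =>
    forall₂_congr fun w hw => ?_
  rw [hmem z (ht _ hb hz) w ((mem_union.1 hw).elim (ht _ ha ·) (ht _ hb ·))]

/-- Ackermann's ordering of the hereditarily finite sets, expressed with quantifiers over the
elements of `M` only. For `M = J1` it holds of `a` and `b` if and only if `code a < code b`. -/
def AckermannLT (M a b : ZFSet.{u}) : Prop :=
  ∃ t ∈ M, ∃ R ∈ M, t.IsTransitive ∧ a ∈ t ∧ b ∈ t ∧ IsAckermannRel R t ∧ pair a b ∈ R

theorem ackermannLT_J1_iff {a b : ZFSet.{u}} (ha : a ∈ J1) (hb : b ∈ J1) :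
    AckermannLT J1 a b ↔ code a < code b := by
  constructor
  · rintro ⟨t, htJ, R, -, ht, hat, hbt, hR, hab⟩
    exact (hR.pair_mem_iff ht (isTransitive_J1 _ htJ) hat hbt).1 hab
  · intro hab
    obtain ⟨t, htJ, ht, hat, hbt⟩ := exists_isTransitive_mem_J1 ha hb
    obtain ⟨R, hRJ, hR⟩ := exists_isAckermannRel ht htJ
    exact ⟨t, htJ, R, hRJ, ht, hat, hbt, hR,
      (hR.pair_mem_iff ht (isTransitive_J1 _ htJ) hat hbt).2 hab⟩

theorem IsRudimentaryRel.isAckermannRel {n : ℕ} {f g : (Fin n → ZFSet.{u}) → ZFSet.{u}}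
    (hf : IsRudimentary n f) (hg : IsRudimentary n g) :
    IsRudimentaryRel n fun v => IsAckermannRel (f v) (g v) := by
  suffices h : IsRudimentaryRel 2 fun v => IsAckermannRel (v 0) (v 1) from
    h.comp (H := ![f, g]) (by simp [Fin.forall_fin_succ, hf, hg])
  unfold IsAckermannRel
  apply_rules [IsRudimentary.proj, exists_mem, forall_mem, IsRudimentaryRel.not,
    IsRudimentaryRel.and, IsRudimentaryRel.iff, imp, mem, IsRudimentary.kpair,
    IsRudimentary.union']

theorem IsRudimentaryRel.ackermannLT {n : ℕ} {f g h : (Fin n → ZFSet.{u}) → ZFSet.{u}}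
    (hf : IsRudimentary n f) (hg : IsRudimentary n g) (hh : IsRudimentary n h) :
    IsRudimentaryRel n fun v => AckermannLT (f v) (g v) (h v) := by
  suffices hlt : IsRudimentaryRel 3 fun v => AckermannLT (v 0) (v 1) (v 2) from
    hlt.comp (H := ![f, g, h]) (by simp [Fin.forall_fin_succ, hf, hg, hh])
  unfold AckermannLT
  apply_rules [IsRudimentary.proj, exists_mem, IsRudimentaryRel.and, mem, isTransitive,
    isAckermannRel, IsRudimentary.kpair]

/-! ### Enumeration of the sets in `J2` -/

/-- The hereditarily finite `a` with `F a ∈ x` that are least in Ackermann's ordering for their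
value `F a`; they serve as unique parameters for the elements of `x`. -/
noncomputable def leastParams (F : ZFSet.{u} → ZFSet.{u}) (x : ZFSet.{u}) : ZFSet.{u} :=
  J1.sep fun a => F a ∈ x ∧ ∀ b ∈ J1, F b = F a → ¬ AckermannLT J1 b a

theorem mem_leastParams_iff {F : ZFSet.{u} → ZFSet.{u}} {x a : ZFSet.{u}} :
    a ∈ leastParams F x ↔ a ∈ J1 ∧ F a ∈ x ∧ ∀ b ∈ J1, F b = F a → code a ≤ code b := by
  simp only [leastParams, mem_sep]
  refine and_congr_right fun ha => and_congr_right fun _ => forall₂_congr fun b hb => ?_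
  rw [ackermannLT_J1_iff hb ha, not_lt]

theorem bijOn_leastParams {F : ZFSet.{u} → ZFSet.{u}} {x : ZFSet.{u}}
    (hF : Set.SurjOn F J1 x) : Set.BijOn F (leastParams F x) x := by
  refine ⟨fun a ha => (mem_leastParams_iff.1 ha).2.1, fun a ha b hb hab => ?_, fun y hy => ?_⟩
  · obtain ⟨haJ, -, hamin⟩ := mem_leastParams_iff.1 ha
    obtain ⟨hbJ, -, hbmin⟩ := mem_leastParams_iff.1 hb
    exact code_injOn haJ hbJ (le_antisymm (hamin b hbJ hab.symm) (hbmin a haJ hab))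
  · obtain ⟨a, ⟨ha, rfl⟩, hmin⟩ := exists_minimalFor_of_wellFoundedLT
      (fun a => a ∈ J1 ∧ F a = y) code (hF hy)
    exact ⟨a, mem_leastParams_iff.2 ⟨ha, hy, fun b hb hba =>
      (le_total _ _).elim id (hmin ⟨hb, hba⟩)⟩, rfl⟩

theorem leastParams_mem_J2 {F : ZFSet.{u} → ZFSet.{u} → ZFSet.{u}}
    (hF : IsRudimentary 2 fun v => F (v 0) (v 1)) {x : ZFSet.{u}} (hx : x ∈ J2) :
    leastParams (F J1) x ∈ J2 := by
  refine rudClosed_J2.sep_mem (n := 2) (c := ![J1, x])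
    (P := fun a c => F (c 0) a ∈ c 1 ∧
      ∀ b ∈ c 0, F (c 0) b = F (c 0) a → ¬ AckermannLT (c 0) b a)
    ?_ J1_mem_J2 (by simp [Fin.forall_fin_succ, J1_mem_J2, hx])
  exact .and (.mem (hF.comp₂ (.proj 1) (.proj 0)) (.proj 2))
    (.forall_mem (.proj 1)
      (.imp (.eq (hF.comp₂ (.proj 2) (.proj 0)) (hF.comp₂ (.proj 2) (.proj 1)))
        (.not (.ackermannLT (.proj 2) (.proj 0) (.proj 1)))))

theorem exists_equiv_subset_J1 {x : ZFSet.{u}} (hx : x ∈ J2) :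
    ∃ A ∈ J2, A ⊆ J1 ∧ ∃ e : A ≃ x, funGraph e ∈ J2 := by
  obtain ⟨F, hF, hFx⟩ := isParametrized_of_mem_rudClosure rudClosed_J1 empty_mem_J1
    isTransitive_J1 hx
  have hA : leastParams (F J1) x ∈ J2 := leastParams_mem_J2 hF hx
  refine ⟨_, hA, sep_subset, (bijOn_leastParams hFx).equiv _, ?_⟩
  exact rudClosed_J2.funGraph_mem (n := 1) (c := ![J1]) (P := fun a y c => F (c 0) a = y)
    (.eq (hF.comp₂ (.proj 2) (.proj 0)) (.proj 1)) hA hx (by simp [J1_mem_J2]) fun _ _ => Iff.rfl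

/-- As a set of pairs, `h` relates each element of `x` to some element of `y` to which it relates no
other element of `x`. It is used to compare cardinalities inside `J1`. -/
def IsInjectiveRel (h x y : ZFSet.{u}) : Prop :=
  ∀ k ∈ x, ∃ z ∈ y, pair k z ∈ h ∧ ∀ l ∈ x, pair l z ∈ h → l = k

theorem IsRudimentaryRel.isInjectiveRel {n : ℕ} {f g h : (Fin n → ZFSet.{u}) → ZFSet.{u}}
    (hf : IsRudimentary n f) (hg : IsRudimentary n g) (hh : IsRudimentary n h) :
    IsRudimentaryRel n fun v => IsInjectiveRel (f v) (g v) (h v) := by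
  suffices hrel : IsRudimentaryRel 3 fun v => IsInjectiveRel (v 0) (v 1) (v 2) from
    hrel.comp (H := ![f, g, h]) (by simp [Fin.forall_fin_succ, hf, hg, hh])
  unfold IsInjectiveRel
  apply_rules [IsRudimentary.proj, exists_mem, forall_mem, IsRudimentaryRel.and, imp, mem,
    IsRudimentaryRel.eq, IsRudimentary.kpair]

theorem exists_isInjectiveRel_iff {x y : ZFSet.{u}} (hx : x ∈ J1) (hy : y ∈ J1) :
    (∃ h ∈ J1, IsInjectiveRel h x y) ↔
      (x : Set ZFSet.{u}).ncard ≤ (y : Set ZFSet.{u}).ncard := by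
  constructor
  · rintro ⟨h, -, hh⟩
    choose! f hf hfh hinj using hh
    exact Set.ncard_le_ncard_of_injOn f hf
      (fun k hk l hl hkl => hinj l hl k hk (hkl ▸ hfh k hk)) (mem_J1_iff.1 hy).1
  · intro hxy
    have : Finite x := (mem_J1_iff.1 hx).1
    have : Finite y := (mem_J1_iff.1 hy).1
    have := Fintype.ofFinite x
    have := Fintype.ofFinite y
    obtain ⟨e⟩ := Function.Embedding.nonempty_of_card_le (α := x) (β := y)
      (by rwa [Fintype.card_eq_nat_card, Fintype.card_eq_nat_card])
    refine ⟨funGraph e, rudClosed_J1.funGraph_mem_of_finite empty_mem_J1 (mem_J1_iff.1 hx).1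
      (isTransitive_J1 x hx) (isTransitive_J1 y hy) e, fun k hk => ⟨e ⟨k, hk⟩, (e ⟨k, hk⟩).2,
        pair_mem_funGraph.2 ⟨hk, rfl⟩, fun l _ hlk => ?_⟩⟩
    obtain ⟨hl, hlk⟩ := pair_mem_funGraph.1 hlk
    exact congrArg Subtype.val (e.injective (Subtype.ext hlk))

open Classical in
/-- The number of elements of `A` whose code is less than that of `a`. -/
noncomputable def codeIndex (A a : ZFSet.{u}) : ℕ :=
  Nat.count (· ∈ code '' (A : Set ZFSet.{u})) (code a)

theorem bijective_codeIndex {A : ZFSet.{u}} (hAJ : A ⊆ J1)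
    (hA : (A : Set ZFSet.{u}).Infinite) : Function.Bijective fun a : A => codeIndex A a := by
  classical
  have hinf : (code '' (A : Set ZFSet.{u})).Infinite :=
    (Set.infinite_image_iff (code_injOn.mono hAJ)).2 hA
  have hnth : ∀ a ∈ A, Nat.nth (· ∈ code '' (A : Set ZFSet.{u})) (codeIndex A a) = code a :=
    fun a ha => Nat.nth_count (p := (· ∈ code '' (A : Set ZFSet.{u}))) ⟨a, ha, rfl⟩
  constructor
  · rintro ⟨a, ha⟩ ⟨b, hb⟩ (hab : codeIndex A a = codeIndex A b)
    exact Subtype.ext <| code_injOn (hAJ ha) (hAJ hb) <| by rw [← hnth a ha, hab, hnth b hb]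
  · intro n
    obtain ⟨a, ha, hna⟩ := Nat.nth_mem_of_infinite hinf n
    exact ⟨⟨a, ha⟩, by simp only [codeIndex, hna]; exact Nat.count_nth_of_infinite hinf n⟩

theorem image_code_sep_ackermannLT {A a : ZFSet.{u}} (hAJ : A ⊆ J1) (ha : a ∈ J1) :
    code '' (A.sep (AckermannLT J1 · a) : Set ZFSet.{u}) =
      {i ∈ code '' (A : Set ZFSet.{u}) | i < code a} := by
  ext i
  simp only [Set.mem_image, SetLike.mem_coe, mem_sep]
  constructor
  · rintro ⟨b, ⟨hb, hlt⟩, rfl⟩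
    exact ⟨⟨b, hb, rfl⟩, (ackermannLT_J1_iff (hAJ hb) ha).1 hlt⟩
  · rintro ⟨⟨b, hb, rfl⟩, hlt⟩
    exact ⟨b, ⟨hb, (ackermannLT_J1_iff (hAJ hb) ha).2 hlt⟩, rfl⟩

theorem sep_ackermannLT_mem_J1 {A a : ZFSet.{u}} (hAJ : A ⊆ J1) (ha : a ∈ J1) :
    A.sep (AckermannLT J1 · a) ∈ J1 := by
  have hsub : A.sep (AckermannLT J1 · a) ⊆ J1 := sep_subset.trans hAJ
  refine mem_J1_iff.2 ⟨Set.Finite.of_finite_image ?_ (code_injOn.mono hsub), hsub⟩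
  rw [image_code_sep_ackermannLT hAJ ha]
  exact (Set.finite_Iio (code a)).subset fun i hi => hi.2

theorem ncard_sep_ackermannLT {A a : ZFSet.{u}} (hAJ : A ⊆ J1) (ha : a ∈ J1) :
    (A.sep (AckermannLT J1 · a) : Set ZFSet.{u}).ncard = codeIndex A a := by
  classical
  have hsub : A.sep (AckermannLT J1 · a) ⊆ J1 := sep_subset.trans hAJ
  rw [← (code_injOn.mono hsub).ncard_image, image_code_sep_ackermannLT hAJ ha, codeIndex,
    Nat.count_eq_card_filter_range, ← Set.ncard_coe_finset]
  congr 1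
  ext i
  simp [and_comm]

theorem natSet_codeIndex_eq_iff {A a y : ZFSet.{u}} (hAJ : A ⊆ J1) (ha : a ∈ J1)
    (hy : y ∈ (omega : ZFSet.{u})) :
    natSet (codeIndex A a) = y ↔
      (∃ h ∈ J1, IsInjectiveRel h (A.sep (AckermannLT J1 · a)) y) ∧
        ∃ h ∈ J1, IsInjectiveRel h y (A.sep (AckermannLT J1 · a)) := by
  obtain ⟨n, rfl⟩ := mem_omega_iff.1 hy
  have hB := sep_ackermannLT_mem_J1 hAJ ha
  have hn := natSet_mem_J1.{u} n
  rw [exists_isInjectiveRel_iff hB hn, exists_isInjectiveRel_iff hn hB, ← le_antisymm_iff,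
    ncard_natSet, ncard_sep_ackermannLT hAJ ha, natSet_injective.eq_iff]

theorem exists_equiv_omega {A : ZFSet.{u}} (hA : A ∈ J2) (hAJ : A ⊆ J1)
    (hAinf : (A : Set ZFSet.{u}).Infinite) :
    ∃ e : A ≃ (omega : ZFSet.{u}), funGraph e ∈ J2 := by
  have hnat : Function.Bijective
      fun n => (⟨natSet n, mem_omega_iff.2 ⟨n, rfl⟩⟩ : (omega : ZFSet.{u})) :=
    ⟨fun m n hmn => natSet_injective (congrArg Subtype.val hmn), fun ⟨y, hy⟩ =>
      (mem_omega_iff.1 hy).imp fun n hn => Subtype.ext hn.symm⟩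
  refine ⟨.ofBijective _ (hnat.comp (bijective_codeIndex hAJ hAinf)), ?_⟩
  refine rudClosed_J2.funGraph_mem (n := 2) (c := ![J1, A])
    (P := fun a y c =>
      (∃ h ∈ c 0, IsInjectiveRel h ((c 1).sep (AckermannLT (c 0) · a)) y) ∧
        ∃ h ∈ c 0, IsInjectiveRel h y ((c 1).sep (AckermannLT (c 0) · a)))
    ?_ hA omega_mem_J2 (by simp [Fin.forall_fin_succ, J1_mem_J2, hA])
    fun a y => natSet_codeIndex_eq_iff hAJ (hAJ a.2) y.2
  have hpred : IsRudimentary 5 fun w : Fin 5 → ZFSet.{u} =>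
      (w 4).sep (AckermannLT (w 3) · (w 1)) :=
    .sep (.proj 4) (.ackermannLT (.proj 4) (.proj 0) (.proj 2))
  exact .and (.exists_mem (.proj 2) (.isInjectiveRel (.proj 0) hpred (.proj 2)))
    (.exists_mem (.proj 2) (.isInjectiveRel (.proj 0) (.proj 2) hpred))

/-! ### ι-sets and ι-bijections -/

theorem isDefinableSubset_of_mem {x M : ZFSet.{u}} (hM : M.IsTransitive) (hx : x ∈ M) :
    IsDefinableSubset x M := by
  refine ⟨hM x hx, ?_⟩
  let c : (setLang.withConstants (Set.univ : Set M)).Term (Fin 1) :=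
    (setLang.con (⟨⟨x, hx⟩, trivial⟩ : (Set.univ : Set M))).term
  let r : (setLang.withConstants (Set.univ : Set M)).Relations 2 := Sum.inl SetLangRel.mem
  refine ⟨r.formula₂ (.var 0) c, ?_⟩
  ext v
  change (v 0).1 ∈ x ↔ (r.formula₂ (.var 0) c).Realize v
  rw [FirstOrder.Language.Formula.realize_rel₂]
  rfl

theorem isIotaClass_of_mem_J2 {x : ZFSet.{u}} (hx : x ∈ J2) : IsIotaClass x :=
  ⟨isDefinableSubset_of_mem isTransitive_J2 hx, fun _ hy => rudClosed_J2.inter_mem hx hy⟩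

theorem isIotaFun_of_funGraph_mem_J2 {X Y : ZFSet.{u}} (hX : X ∈ J2) (hY : Y ∈ J2) {F : X → Y}
    (hF : funGraph F ∈ J2) : IsIotaFun F :=
  ⟨isIotaClass_of_mem_J2 hX, isIotaClass_of_mem_J2 hY, isIotaClass_of_mem_J2 hF,
    fun _ _ _ => ⟨Y, hY, fun a _ => (F a).2⟩⟩

theorem isIotaBijection_of_funGraph_mem_J2 {X Y : ZFSet.{u}} (hX : X ∈ J2) (hY : Y ∈ J2)
    {F : X ≃ Y} (hF : funGraph F ∈ J2) : IsIotaBijection F :=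
  ⟨isIotaFun_of_funGraph_mem_J2 hX hY hF,
    isIotaFun_of_funGraph_mem_J2 hY hX (rudClosed_J2.funGraph_symm_mem hX hY hF)⟩

theorem theorem2p10 (x : ZFSet.{u}) (hx : IsIotaSet x) :
    ((x : Set ZFSet.{u}).Infinite →
      ∃ F : (ZFSet.omega : ZFSet.{u}) ≃ x, IsIotaBijection F) ∧
    ((x : Set ZFSet.{u}).Finite →
      ∃ n ∈ (ZFSet.omega : ZFSet.{u}), ∃ F : n ≃ x, IsIotaBijection F) := by
  constructor
  · intro hinf
    obtain ⟨A, hA, hAJ, e, he⟩ := exists_equiv_subset_J1 hx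
    have hAinf : (A : Set ZFSet.{u}).Infinite :=
      Set.infinite_coe_iff.1 (e.infinite_iff.2 (Set.infinite_coe_iff.2 hinf))
    obtain ⟨f, hf⟩ := exists_equiv_omega hA hAJ hAinf
    exact ⟨f.symm.trans e, isIotaBijection_of_funGraph_mem_J2 omega_mem_J2 hx <|
      rudClosed_J2.funGraph_trans_mem omega_mem_J2 hA hx
        (rudClosed_J2.funGraph_symm_mem hA omega_mem_J2 hf) he⟩
  · intro hfin
    let n := natSet.{u} (x : Set ZFSet.{u}).ncard
    have hn : n ∈ J1 := natSet_mem_J1 _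
    have hnfin : (n : Set ZFSet.{u}).Finite := (mem_J1_iff.1 hn).1
    have : Finite n := hnfin
    have : Finite x := hfin
    obtain ⟨F⟩ : Nonempty (n ≃ x) := Finite.card_eq.1 (ncard_natSet _)
    refine ⟨n, mem_omega_iff.2 ⟨_, rfl⟩, F, ?_⟩
    exact isIotaBijection_of_funGraph_mem_J2 (J1_subset_J2 hn) hx <|
      rudClosed_J2.funGraph_mem_of_finite (J1_subset_J2 empty_mem_J1) hnfin
        ((isTransitive_J1 n hn).trans J1_subset_J2) (isTransitive_J2 x hx) F
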